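/- Let $\mathcal G_1,\dots,\mathcal G_D$ be finite, connected, undirected graphs with positive edge weights, on disjoint node sets $\mathcal V_1,\dots,\mathcal V_D$, with weighted Laplacians $\mathbf L_1,\dots,\mathbf L_D$, and let a weighted undirected graph $\widehat{\mathcal G}_{con}$ on $\{1,\dots,D\}$ with positive edge weights $w_{con}(k,l)$ be given. For a choice $s=(s_1,\dots,s_D)$ of connecting nodes $s_k\in\mathcal V_k$, let $\mathcal G_{con}$ be the graph on $\mathcal V=\bigcup_k\mathcal V_k$ in which $s_k$ and $s_l$ are joined by an edge of weight $w_{con}(k,l)$ whenever $k,l$ are adjacent in $\widehat{\mathcal G}_{con}$, and let $\mathbf L_{con}$ be its weighted Laplacian. Let $\mathbf L=\mathbf L_{sub}+\epsilon\mathbf L_{con}$ be the supra-Laplacian, where $\mathbf L_{sub}$ is block diagonal with blocks $\mathbf L_1,\dots,\mathbf L_D$, and let $\lambda_1(\mathbf L)\le\lambda_2(\mathbf L)\le\cdots$ be its eigenvalues with multiplicity. The $n$-th order approximation of $\lambda_i(\mathbf L)$ is the polynomial $p$ in $\epsilon$ of degree at most $n$ with $\lambda_i(\mathbf L)=p(\epsilon)+o(\epsilon^n)$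 as $\epsilon\to0^+$. The information centrality of a node $r$ of a connected weighted graph with $m$ nodes and Laplacian $L$ is $\bigl(\tfrac1m\sum_{v}1/I(r,v)\bigr)^{-1}$, where $1/I(r,v)=c_{rr}+c_{vv}-2c_{rv}$, $C=(c_{rv})=(L+J)^{-1}$ and $J$ is the all-ones matrix (for $m=1$ it is given any fixed value). Then, for every $i=2,\dots,D$: 1. If $\widehat{\mathcal G}_{con}$ is connected, then $\lambda_i(\mathbf L)>0$ for every $\epsilon>0$ and every choice of connecting nodes. 2. Whether or not $\widehat{\mathcal G}_{con}$ is connected, the first-order approximation of $\lambda_i(\mathbf L)$ exists and is the same for all choices of the connecting nodes. 3. Whether or not $\widehat{\mathcal G}_{con}$ is connected, the second-order approximation of $\lambda_i(\mathbf L)$ exists for every choice of connecting nodes, and if each $t_k$ is a node of maximum information centrality in $\mathcal G_k$, then, for every $\epsilon>0$, the second-order approximation for the choice $t=(t_1,\dots,t_D)$ is at least the one for any other choice $s$. Moreover, for every $k$, a node $r\in\mathcal V_k$ of maximum information centrality in $\mathcal G_k$ minimizes the diagonal entry $\mathbf L_k^{\dagger}(r,r)$ of the Moore-Penrose inverse $\mathbf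 L_k^{\dagger}$ of $\mathbf L_k$ over all nodes of $\mathcal G_k$. -/

import Mathlib

open Filter Topology Asymptotics

/-- A weighted undirected graph without loops on the vertex set `V`: every edge carries a positive
weight, and `weight u v = 0` when `u` and `v` are not adjacent. -/
structure WeightedGraph (V : Type*) where
  graph : SimpleGraph V
  weight : V → V → ℝ
  weight_symm : ∀ u v, weight u v = weight v u
  weight_pos : ∀ u v, graph.Adj u v → 0 < weight u v
  weight_eq_zero : ∀ u v, ¬ graph.Adj u v → weight u v = 0

namespace WeightedGraph

/-- The weighted Laplacian matrix. -/
def lap {V : Type*} [Fintype V] [DecidableEq V] (G : WeightedGraph V) : Matrix V V ℝ :=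
  fun r s => if r = s then ∑ u, G.weight r u else - G.weight r s

theorem lap_isHermitian {V : Type*} [Fintype V] [DecidableEq V] (G : WeightedGraph V) :
    G.lap.IsHermitian := by
  ext r s
  by_cases h : r = s
  · subst h; simp
  · simp [lap, h, Ne.symm h, G.weight_symm s r]

/-- Stephenson and Zelen's matrix `C = (L + J)⁻¹`, with `J` the all-ones matrix. -/
noncomputable def infoMatrix {V : Type*} [Fintype V] [DecidableEq V] (G : WeightedGraph V) :
    Matrix V V ℝ :=
  (G.lap + Matrix.of fun _ _ => (1 : ℝ))⁻¹

/-- The information `I(r,s) = 1 / (c(r,r) + c(s,s) - 2 c(r,s))` between `r` and `s`.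
For `r = s` it is infinite; the value `0` that it gets here has the right reciprocal `0`. -/
noncomputable def information {V : Type*} [Fintype V] [DecidableEq V] (G : WeightedGraph V)
    (r s : V) : ℝ :=
  (G.infoMatrix r r + G.infoMatrix s s - 2 * G.infoMatrix r s)⁻¹

/-- The information centrality of a node `r`: the harmonic mean of the `I(r,s)` over all nodes
`s`. -/
noncomputable def infoCentrality {V : Type*} [Fintype V] [DecidableEq V] (G : WeightedGraph V)
    (r : V) : ℝ :=
  ((∑ s, (G.information r s)⁻¹) / (Fintype.card V : ℝ))⁻¹

/-- `r` is a node of maximum information centrality. -/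
def IsMaxInfoCentrality {V : Type*} [Fintype V] [DecidableEq V] (G : WeightedGraph V)
    (r : V) : Prop :=
  ∀ v, G.infoCentrality v ≤ G.infoCentrality r

end WeightedGraph

/-- The four Penrose equations: `X` is the Moore-Penrose inverse of the real matrix `A`. -/
structure IsMoorePenroseInverse {n : Type*} [Fintype n] (A X : Matrix n n ℝ) : Prop where
  mul_mul_self : A * X * A = A
  self_mul_mul : X * A * X = X
  symm_left : (A * X).transpose = A * X
  symm_right : (X * A).transpose = X * A

/-- The Moore-Penrose inverse of a symmetric real matrix `A = U diag(d) Uᵀ`, that is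
`U diag(d⁻¹) Uᵀ` with `0⁻¹ = 0`. -/
noncomputable def symmPinv {n : Type*} [Fintype n] [DecidableEq n] {A : Matrix n n ℝ}
    (hA : A.IsHermitian) : Matrix n n ℝ :=
  (hA.eigenvectorUnitary : Matrix n n ℝ) * Matrix.diagonal (fun j => (hA.eigenvalues j)⁻¹) *
    (hA.eigenvectorUnitary : Matrix n n ℝ).transpose

theorem symmPinv_isMoorePenroseInverse {n : Type*} [Fintype n] [DecidableEq n]
    {A : Matrix n n ℝ} (hA : A.IsHermitian) : IsMoorePenroseInverse A (symmPinv hA) := by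
  obtain ⟨U, hU⟩ : ∃ U : Matrix n n ℝ, U = (hA.eigenvectorUnitary : Matrix n n ℝ) := ⟨_, rfl⟩
  have hUU : U.transpose * U = 1 := by
    have := Unitary.coe_star_mul_self hA.eigenvectorUnitary
    rw [hU]
    simpa [Matrix.star_eq_conjTranspose] using this
  have key : ∀ d e : n → ℝ, (U * Matrix.diagonal d * U.transpose) *
      (U * Matrix.diagonal e * U.transpose) =
      U * Matrix.diagonal (fun j => d j * e j) * U.transpose := by
    intro d e
    calc _ = U * Matrix.diagonal d * (U.transpose * U) * Matrix.diagonal e * U.transpose := by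
          simp only [Matrix.mul_assoc]
      _ = _ := by rw [hUU, Matrix.mul_one, Matrix.mul_assoc U, Matrix.diagonal_mul_diagonal]
  have hT : ∀ d : n → ℝ, (U * Matrix.diagonal d * U.transpose).transpose =
      U * Matrix.diagonal d * U.transpose := by
    intro d
    simp [Matrix.transpose_mul, Matrix.mul_assoc]
  have hAe : A = U * Matrix.diagonal hA.eigenvalues * U.transpose := by
    have h := hA.spectral_theorem
    rw [Unitary.conjStarAlgAut_apply, ← hU] at h
    simpa [Matrix.star_eq_conjTranspose, Function.comp_def] using h
  have hX : symmPinv hA = U * Matrix.diagonal (fun j => (hA.eigenvalues j)⁻¹) * U.transpose := by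
    rw [symmPinv, hU]
  generalize symmPinv hA = X at hX
  generalize hA.eigenvalues = d at hAe hX
  subst hX
  rw [hAe]
  refine ⟨?_, ?_, ?_, ?_⟩
  · rw [key, key]; simp
  · rw [key, key]; congr 3; ext j
    by_cases h : d j = 0 <;> simp [h]
  · rw [key, hT]
  · rw [key, hT]

/-- The `i`-th smallest eigenvalue (counted from `0`, with multiplicity) of a symmetric real
matrix. -/
noncomputable def ascEigenvalue {n : Type*} [Fintype n] [DecidableEq n] {A : Matrix n n ℝ}
    (hA : A.IsHermitian) (i : Fin (Fintype.card n)) : ℝ :=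
  hA.eigenvalues₀ (Fin.rev i)

/-- A network of networks: `D` connected weighted subgraphs with finite vertex sets `V k`, and the
weighted graph `con` on `{1, …, D}` that prescribes which subgraphs are joined by a connecting
edge, and with which weight. The choice of the connecting nodes is not part of the data. -/
structure NetworkOfNetworks (D : ℕ) (V : Fin D → Type*) where
  sub : ∀ k, WeightedGraph (V k)
  connected : ∀ k, (sub k).graph.Connected
  con : WeightedGraph (Fin D)

namespace NetworkOfNetworks

/-- The connecting graph on the disjoint union of the vertex sets: the connecting node `s k` of
subgraph `k` is joined to the connecting node `s l` of subgraph `l` with the weight that `con`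
gives to `k, l`. -/
def connectingGraph {D : ℕ} {V : Fin D → Type*} [∀ k, DecidableEq (V k)]
    (S : NetworkOfNetworks D V) (s : ∀ k, V k) : WeightedGraph (Σ k, V k) where
  graph :=
    { Adj := fun p q => S.con.graph.Adj p.1 q.1 ∧ p.2 = s p.1 ∧ q.2 = s q.1
      symm := ⟨fun _ _ h => ⟨h.1.symm, h.2.2, h.2.1⟩⟩
      loopless := ⟨fun _ h => h.1.ne rfl⟩ }
  weight := fun p q => if p.2 = s p.1 ∧ q.2 = s q.1 then S.con.weight p.1 q.1 else 0
  weight_symm := by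
    intro p q
    simp only [S.con.weight_symm p.1 q.1, and_comm]
  weight_pos := by
    rintro p q ⟨h, hpq⟩
    rw [if_pos hpq]
    exact S.con.weight_pos _ _ h
  weight_eq_zero := by
    intro p q h
    split_ifs with hpq
    · exact S.con.weight_eq_zero _ _ fun hc => h ⟨hc, hpq⟩
    · rfl

/-- The supra-Laplacian `L = L_sub + ε L_con` for the connecting nodes `s`, where `L_sub` is block
diagonal with the Laplacians of the subgraphs as blocks. -/
noncomputable def supraLaplacian {D : ℕ} {V : Fin D → Type*} [∀ k, Fintype (V k)]
    [∀ k, DecidableEq (V k)] (S : NetworkOfNetworks D V) (s : ∀ k, V k) (ε : ℝ) :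
    Matrix (Σ k, V k) (Σ k, V k) ℝ :=
  Matrix.blockDiagonal' (fun k => (S.sub k).lap) + ε • (S.connectingGraph s).lap

theorem supraLaplacian_isHermitian {D : ℕ} {V : Fin D → Type*} [∀ k, Fintype (V k)]
    [∀ k, DecidableEq (V k)] (S : NetworkOfNetworks D V) (s : ∀ k, V k) (ε : ℝ) :
    (S.supraLaplacian s ε).IsHermitian := by
  have h1 : (Matrix.blockDiagonal' (fun k => (S.sub k).lap)).IsHermitian := by
    rw [Matrix.IsHermitian, Matrix.blockDiagonal'_conjTranspose]
    congr 1
    funext k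
    exact (S.sub k).lap_isHermitian
  have h2 : (ε • (S.connectingGraph s).lap).IsHermitian := by
    rw [Matrix.IsHermitian, Matrix.conjTranspose_smul, (S.connectingGraph s).lap_isHermitian.eq]
    simp
  exact h1.add h2

theorem le_card {D : ℕ} {V : Fin D → Type*} [∀ k, Fintype (V k)] (s : ∀ k, V k) :
    D ≤ Fintype.card (Σ k, V k) := by
  have h := Fintype.card_le_of_injective (fun k : Fin D => (⟨k, s k⟩ : Σ k, V k))
    fun a b hab => congrArg Sigma.fst hab
  simpa using h

/-- The `i`-th smallest eigenvalue of the supra-Laplacian, for `i` among the first `D` indices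
(counted from `0`). -/
noncomputable def eigenvalue {D : ℕ} {V : Fin D → Type*} [∀ k, Fintype (V k)]
    [∀ k, DecidableEq (V k)] (S : NetworkOfNetworks D V) (s : ∀ k, V k) (i : Fin D) (ε : ℝ) : ℝ :=
  ascEigenvalue (S.supraLaplacian_isHermitian s ε) (Fin.castLE (le_card s) i)

end NetworkOfNetworks

/-- `p` is the approximation of `f` up to order `n` as `ε → 0+`: the polynomial of degree at most
`n` (unique if it exists) with `f ε = p ε + o(ε ^ n)`. -/
def IsApproxUpToOrder (n : ℕ) (f : ℝ → ℝ) (p : Polynomial ℝ) : Prop :=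
  p.natDegree ≤ n ∧ (fun ε => f ε - p.eval ε) =o[𝓝[>] 0] fun ε => ε ^ n

/-! ### Variational principles for ordered eigenvalues of symmetric matrices. -/

section Spectral

open Matrix

variable {n m : Type*} [Fintype n] [DecidableEq n] [Fintype m] [DecidableEq m]

/-! Write `A` for the block-diagonal Laplacian, `B` for the connecting one, `X` for the
Moore-Penrose inverse of `A`, and `U` for the isometry of `ℝ^D` onto `ker A`. Second-order
degenerate perturbation theory replaces the `D` smallest eigenvalues of `A + εB` by those of the `D
× D` matrix `H(ε) = UᵀBU - ε UᵀBXBU`: the `i`-th eigenvalue is `ε h_i(ε) + O(ε³)`, where `h_i(ε)` is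
the `i`-th eigenvalue of `H(ε)` (`IsKernelData.ascEigenvalue_le`, `IsKernelData.le_ascEigenvalue`).
Both bounds are variational, so multiple eigenvalues need no separate treatment. Each `h_i` is a
difference of two concave Ky Fan sums, hence has a right derivative at `0`
(`exists_hasDerivWithinAt_ascEigenvalue`), and the second-order approximation is `h_i(0) ε +
h_i'(0+) ε²`.

The choice `s` enters through evaluation `E` at the connecting nodes: `B = Eᵀ L̂ E`, with `L̂` the
Laplacian of the prescribed graph on `{1, …, D}`. Kernel vectors are constant on blocks, so `EU`,
and with it `H(0)`, does not depend on `s`. Since `E X Eᵀ` is diagonal with entries `L_k†(s_k,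
s_k)`, smaller entries give a larger `H(ε)` and, by Weyl, larger `h_i(ε)`. All choices share
`h_i(0)`, so the order passes to the slopes at `0`.

Finally `(L + J)⁻¹ = L† + J/m²` makes information centrality the reciprocal of `L†(r,r) + tr(L†)/m`,
so maximal centrality means minimal `L†(r,r)` (`IsMaxInfoCentrality.lapPinv_le`). Positivity is
separate: a vector with zero form is constant on the connected network. -/

theorem ascEigenvalue_monotone {A : Matrix n n ℝ} (hA : A.IsHermitian) :
    Monotone (ascEigenvalue hA) := fun _ _ h =>
  hA.eigenvalues₀_antitone (Fin.rev_le_rev.mpr h)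

theorem exists_ascEigenvalue_decomposition {A : Matrix n n ℝ} (hA : A.IsHermitian) :
    ∃ W : Matrix (Fin (Fintype.card n)) n ℝ, W * Wᵀ = 1 ∧ Wᵀ * W = 1 ∧
      A = Wᵀ * diagonal (ascEigenvalue hA) * W := by
  obtain ⟨U, hU⟩ : ∃ U : Matrix n n ℝ, U = (hA.eigenvectorUnitary : Matrix n n ℝ) := ⟨_, rfl⟩
  have hUU : Uᵀ * U = 1 := by
    have := Unitary.coe_star_mul_self hA.eigenvectorUnitary
    rw [hU]
    simpa [Matrix.star_eq_conjTranspose] using this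
  have hUU' : U * Uᵀ = 1 := mul_eq_one_comm.mp hUU
  have hAe : A = U * diagonal hA.eigenvalues * Uᵀ := by
    have h := hA.spectral_theorem
    rw [Unitary.conjStarAlgAut_apply, ← hU] at h
    simpa [Matrix.star_eq_conjTranspose, Function.comp_def] using h
  let σ : n ≃ Fin (Fintype.card n) :=
    (Fintype.equivOfCardEq (Fintype.card_fin _)).symm.trans Fin.revPerm
  have hσ : ∀ j, hA.eigenvalues j = ascEigenvalue hA (σ j) := by
    intro j
    simp [σ, ascEigenvalue, IsHermitian.eigenvalues]
  have hd : diagonal (ascEigenvalue hA) =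
      (diagonal hA.eigenvalues).submatrix σ.symm σ.symm := by
    rw [submatrix_diagonal_equiv]
    congr 1
    ext l
    simp [hσ]
  refine ⟨Uᵀ.submatrix σ.symm id, ?_, ?_, ?_⟩
  · rw [transpose_submatrix, ← submatrix_mul _ _ _ _ _ Function.bijective_id, transpose_transpose,
      hUU, submatrix_one_equiv]
  · rw [transpose_submatrix, submatrix_mul_equiv, transpose_transpose, hUU', submatrix_id_id]
  · rw [hd, transpose_submatrix, submatrix_mul_equiv, submatrix_mul_equiv, submatrix_id_id,
      transpose_transpose]
    exact hAe

omit [DecidableEq n] in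
theorem dotProduct_mulVec_eq_sum {N : Type*} [Fintype N] [DecidableEq N] {A : Matrix n n ℝ}
    {W : Matrix N n ℝ} {d : N → ℝ} (hA : A = Wᵀ * diagonal d * W) (x : n → ℝ) :
    x ⬝ᵥ A *ᵥ x = ∑ l, d l * (W *ᵥ x) l ^ 2 := by
  rw [hA, ← mulVec_mulVec, ← mulVec_mulVec, dotProduct_mulVec, vecMul_transpose, dotProduct]
  refine Finset.sum_congr rfl fun l _ => ?_
  rw [mulVec_diagonal]
  ring

theorem dotProduct_self_eq_sum {N : Type*} [Fintype N] [DecidableEq N]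
    {W : Matrix N n ℝ} (hW : Wᵀ * W = 1) (x : n → ℝ) :
    x ⬝ᵥ x = ∑ l, (W *ᵥ x) l ^ 2 := by
  have h := dotProduct_mulVec_eq_sum (A := 1) (W := W) (d := fun _ => 1) (by simp [hW]) x
  simpa using h

/-- The easy half of the Courant-Fischer principle: on the kernel of a linear map of rank at most
`i` some vector has Rayleigh quotient at most the `i`-th smallest eigenvalue. -/
theorem exists_ne_zero_form_le {A : Matrix n n ℝ} (hA : A.IsHermitian) (i : Fin (Fintype.card n))
    {E : Type*} [AddCommGroup E] [Module ℝ E] [FiniteDimensional ℝ E] (F : (n → ℝ) →ₗ[ℝ] E)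
    (hF : Module.finrank ℝ E ≤ i) :
    ∃ x, x ≠ 0 ∧ F x = 0 ∧ x ⬝ᵥ A *ᵥ x ≤ ascEigenvalue hA i * (x ⬝ᵥ x) := by
  obtain ⟨W, -, hW, hAW⟩ := exists_ascEigenvalue_decomposition hA
  -- Besides `F x = 0`, all components along eigenvectors of index above `i` are made to vanish.
  -- This is at most `i + (card n - 1 - i) < card n` conditions, so a nonzero solution exists.
  let G : (n → ℝ) →ₗ[ℝ] E × ({l // i < l} → ℝ) :=
    F.prod ((LinearMap.funLeft ℝ ℝ Subtype.val).comp W.mulVecLin)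
  have hcard : Fintype.card {l // i < l} = Fintype.card n - 1 - i := by
    rw [Fintype.card_subtype, ← Fin.card_Ioi i]
    congr 1
    ext l
    simp
  have hlt : Module.finrank ℝ (E × ({l // i < l} → ℝ)) < Module.finrank ℝ (n → ℝ) := by
    rw [Module.finrank_prod, Module.finrank_fintype_fun_eq_card,
      Module.finrank_fintype_fun_eq_card, hcard]
    have := i.isLt
    omega
  obtain ⟨x, hx, hx0⟩ := (Submodule.ne_bot_iff _).mp (G.ker_ne_bot_of_finrank_lt hlt)
  have hGx : (F x, fun l : {l // i < l} => (W *ᵥ x) l.1) = 0 := hx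
  obtain ⟨h1, h2⟩ := Prod.mk_eq_zero.mp hGx
  refine ⟨x, hx0, h1, ?_⟩
  rw [dotProduct_mulVec_eq_sum hAW, dotProduct_self_eq_sum hW, Finset.mul_sum]
  refine Finset.sum_le_sum fun l _ => ?_
  by_cases hl : i < l
  · have : (W *ᵥ x) l = 0 := congrFun h2 ⟨l, hl⟩
    simp [this]
  · exact mul_le_mul_of_nonneg_right (ascEigenvalue_monotone hA (not_lt.mp hl)) (sq_nonneg _)

/-- Requiring `R x` to be orthogonal to the first `j` eigenvectors of `H` costs only `j ≤ i` linear
conditions, which the Courant-Fischer bound for `A` can afford. This is the common tool for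
comparing eigenvalues of matrices of different sizes, with `R` carrying test vectors from one space
to the other. -/
theorem exists_ne_zero_form_le_and_le_form {A : Matrix n n ℝ} (hA : A.IsHermitian)
    {H : Matrix m m ℝ} (hH : H.IsHermitian) (R : Matrix m n ℝ) (i : Fin (Fintype.card n))
    (j : Fin (Fintype.card m)) (hij : (j : ℕ) ≤ i) :
    ∃ x, x ≠ 0 ∧ x ⬝ᵥ A *ᵥ x ≤ ascEigenvalue hA i * (x ⬝ᵥ x) ∧
      ascEigenvalue hH j * ((R *ᵥ x) ⬝ᵥ (R *ᵥ x)) ≤ (R *ᵥ x) ⬝ᵥ H *ᵥ (R *ᵥ x) := by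
  obtain ⟨W, -, hW, hHW⟩ := exists_ascEigenvalue_decomposition hH
  let F : (n → ℝ) →ₗ[ℝ] ({l // l < j} → ℝ) :=
    (LinearMap.funLeft ℝ ℝ Subtype.val).comp (W.mulVecLin.comp R.mulVecLin)
  have hcard : Fintype.card {l // l < j} = j := by
    rw [Fintype.card_subtype, ← Fin.card_Iio j]
    congr 1
    ext l
    simp
  obtain ⟨x, hx0, hx, hle⟩ := exists_ne_zero_form_le hA i F (by
    rw [Module.finrank_fintype_fun_eq_card, hcard]; exact hij)
  refine ⟨x, hx0, hle, ?_⟩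
  rw [dotProduct_mulVec_eq_sum hHW, dotProduct_self_eq_sum hW, Finset.mul_sum]
  refine Finset.sum_le_sum fun l _ => ?_
  by_cases hl : l < j
  · have : (W *ᵥ R *ᵥ x) l = 0 := congrFun hx ⟨l, hl⟩
    simp [this]
  · exact mul_le_mul_of_nonneg_right (ascEigenvalue_monotone hH (not_lt.mp hl)) (sq_nonneg _)

omit [DecidableEq n] in
theorem dotProduct_self_pos_of_ne_zero {x : n → ℝ} (hx : x ≠ 0) : 0 < x ⬝ᵥ x :=
  lt_of_le_of_ne (Finset.sum_nonneg fun i _ => mul_self_nonneg (x i))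
    fun h => hx (dotProduct_self_eq_zero.mp h.symm)

omit [DecidableEq n] in
theorem dotProduct_self_nonneg_real (x : n → ℝ) : 0 ≤ x ⬝ᵥ x :=
  Finset.sum_nonneg fun i _ => mul_self_nonneg (x i)

theorem ascEigenvalue_nonneg {A : Matrix n n ℝ} (hA : A.IsHermitian)
    (h : ∀ x, 0 ≤ x ⬝ᵥ A *ᵥ x) (i : Fin (Fintype.card n)) : 0 ≤ ascEigenvalue hA i := by
  obtain ⟨x, hx0, -, hx⟩ := exists_ne_zero_form_le hA i (0 : (n → ℝ) →ₗ[ℝ] (Fin 0 → ℝ)) (by simp)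
  exact nonneg_of_mul_nonneg_left ((h x).trans hx) (dotProduct_self_pos_of_ne_zero hx0)

/-- Weyl's monotonicity principle. -/
theorem ascEigenvalue_le_of_form_le {A B : Matrix n n ℝ} (hA : A.IsHermitian)
    (hB : B.IsHermitian) (h : ∀ x, x ⬝ᵥ A *ᵥ x ≤ x ⬝ᵥ B *ᵥ x) (i : Fin (Fintype.card n)) :
    ascEigenvalue hA i ≤ ascEigenvalue hB i := by
  obtain ⟨x, hx0, h1, h2⟩ := exists_ne_zero_form_le_and_le_form hB hA 1 i i le_rfl
  rw [one_mulVec] at h2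
  exact le_of_mul_le_mul_right (h2.trans ((h x).trans h1)) (dotProduct_self_pos_of_ne_zero hx0)

/-- Ky Fan's inequality for the sum of the smallest eigenvalues, over a set `s` of indices that
lies below a threshold `c` in the spectrum. -/
theorem sum_ascEigenvalue_le {A : Matrix n n ℝ} (hA : A.IsHermitian)
    {V : Matrix (Fin (Fintype.card n)) n ℝ} (hV' : Vᵀ * V = 1)
    (s : Finset (Fin (Fintype.card n))) (c : ℝ) (hs : ∀ l ∈ s, ascEigenvalue hA l ≤ c)
    (hs' : ∀ l ∉ s, c ≤ ascEigenvalue hA l) :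
    ∑ l ∈ s, ascEigenvalue hA l ≤ ∑ j ∈ s, V j ⬝ᵥ A *ᵥ V j := by
  obtain ⟨W, hW', hW, hAW⟩ := exists_ascEigenvalue_decomposition hA
  generalize ascEigenvalue hA = d at *
  obtain ⟨O, hO⟩ : ∃ O, O = W * Vᵀ := ⟨_, rfl⟩
  have hOe : ∀ j l, (W *ᵥ V j) l = O l j := by
    intro j l
    rw [hO]
    rfl
  have hO1 : O * Oᵀ = 1 := by
    rw [hO, transpose_mul, transpose_transpose, Matrix.mul_assoc, ← Matrix.mul_assoc Vᵀ, hV',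
      Matrix.one_mul, hW']
  have hO2 : Oᵀ * O = 1 := mul_eq_one_comm.mp hO1
  have hrow : ∀ l, ∑ j, O l j ^ 2 = 1 := by
    intro l
    have := congrFun (congrFun hO1 l) l
    simpa [mul_apply, pow_two] using this
  have hcol : ∀ j, ∑ l, O l j ^ 2 = 1 := by
    intro l
    have := congrFun (congrFun hO2 l) l
    simpa [mul_apply, pow_two] using this
  have hp1 : ∀ l, ∑ j ∈ s, O l j ^ 2 ≤ 1 := fun l =>
    (Finset.sum_le_univ_sum_of_nonneg fun j => sq_nonneg _).trans (hrow l).le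
  have hp0 : ∀ l, 0 ≤ ∑ j ∈ s, O l j ^ 2 := fun l => Finset.sum_nonneg fun j _ => sq_nonneg _
  have hp : ∑ l, ∑ j ∈ s, O l j ^ 2 = s.card := by
    rw [Finset.sum_comm]
    simp [hcol]
  have hq : ∑ j ∈ s, V j ⬝ᵥ A *ᵥ V j = ∑ l, d l * ∑ j ∈ s, O l j ^ 2 := by
    simp_rw [dotProduct_mulVec_eq_sum hAW, hOe, Finset.mul_sum]
    rw [Finset.sum_comm]
  have hsum : ∑ l ∈ s, d l = ∑ l, d l * (if l ∈ s then 1 else 0) := by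
    simp
  have hone : ∑ l, (if l ∈ s then (1 : ℝ) else 0) = s.card := by simp
  -- The weights `∑ j ∈ s, O l j ^ 2` lie in `[0, 1]` and have the same total as the indicator of
  -- `s`. Shifting `d` by `c` therefore changes nothing, and it makes the two factors agree in sign
  -- for every `l`.
  have hnn : 0 ≤ ∑ l, (d l - c) * ((∑ j ∈ s, O l j ^ 2) - if l ∈ s then 1 else 0) := by
    refine Finset.sum_nonneg fun l _ => ?_
    by_cases hl : l ∈ s
    · rw [if_pos hl]
      exact mul_nonneg_of_nonpos_of_nonpos (sub_nonpos.mpr (hs l hl)) (sub_nonpos.mpr (hp1 l))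
    · rw [if_neg hl, sub_zero]
      exact mul_nonneg (sub_nonneg.mpr (hs' l hl)) (hp0 l)
  have hexp : ∑ l, (d l - c) * ((∑ j ∈ s, O l j ^ 2) - if l ∈ s then 1 else 0) =
      (∑ l, d l * ∑ j ∈ s, O l j ^ 2) - (∑ l, d l * (if l ∈ s then 1 else 0)) -
        c * ((∑ l, ∑ j ∈ s, O l j ^ 2) - ∑ l, (if l ∈ s then (1 : ℝ) else 0)) := by
    rw [← Finset.sum_sub_distrib, ← Finset.sum_sub_distrib, Finset.mul_sum,
      ← Finset.sum_sub_distrib]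
    exact Finset.sum_congr rfl fun l _ => by ring
  rw [hexp, hp, hone, sub_self, mul_zero, sub_zero] at hnn
  rw [hsum, hq]
  linarith

theorem sum_ascEigenvalue_eq {A : Matrix n n ℝ} (hA : A.IsHermitian)
    {W : Matrix (Fin (Fintype.card n)) n ℝ} (hW : W * Wᵀ = 1)
    (hAW : A = Wᵀ * diagonal (ascEigenvalue hA) * W) (j : Fin (Fintype.card n)) :
    W j ⬝ᵥ A *ᵥ W j = ascEigenvalue hA j := by
  rw [dotProduct_mulVec_eq_sum hAW]
  have : ∀ l, (W *ᵥ W j) l = (1 : Matrix _ _ ℝ) l j := by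
    intro l
    rw [← hW]
    rfl
  simp [this, one_apply]

/-- Sums of smallest eigenvalues are concave along lines of symmetric matrices. -/
theorem concaveOn_sum_ascEigenvalue {M N : Matrix n n ℝ}
    (h : ∀ ε : ℝ, (M - ε • N).IsHermitian) (i : Fin (Fintype.card n))
    (s : Finset (Fin (Fintype.card n))) (hs : ∀ l ∈ s, l ≤ i) (hs' : ∀ l ∉ s, i ≤ l) :
    ConcaveOn ℝ Set.univ fun ε => ∑ l ∈ s, ascEigenvalue (h ε) l := by
  refine ⟨convex_univ, fun x _ y _ a b ha hb hab => ?_⟩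
  -- An eigenbasis at the intermediate point attains the Ky Fan sum there and is a competitor at
  -- both endpoints; its trace is affine in the parameter.
  obtain ⟨W, hW, hW', hAW⟩ := exists_ascEigenvalue_decomposition (h (a • x + b • y))
  have key : ∀ ε, ∑ l ∈ s, ascEigenvalue (h ε) l ≤ ∑ j ∈ s, W j ⬝ᵥ (M - ε • N) *ᵥ W j :=
    fun ε => sum_ascEigenvalue_le (h ε) hW' s (ascEigenvalue (h ε) i)
      (fun l hl => ascEigenvalue_monotone _ (hs l hl))
      (fun l hl => ascEigenvalue_monotone _ (hs' l hl))
  have hM : M - (a • x + b • y) • N = a • (M - x • N) + b • (M - y • N) := by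
    obtain rfl : b = 1 - a := by linarith
    ext p q
    simp
    ring
  calc a • ∑ l ∈ s, ascEigenvalue (h x) l + b • ∑ l ∈ s, ascEigenvalue (h y) l
      ≤ a • (∑ j ∈ s, W j ⬝ᵥ (M - x • N) *ᵥ W j) + b • ∑ j ∈ s, W j ⬝ᵥ (M - y • N) *ᵥ W j :=
        add_le_add (mul_le_mul_of_nonneg_left (key x) ha) (mul_le_mul_of_nonneg_left (key y) hb)
    _ = ∑ j ∈ s, W j ⬝ᵥ (M - (a • x + b • y) • N) *ᵥ W j := by
        rw [Finset.smul_sum, Finset.smul_sum, ← Finset.sum_add_distrib, hM]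
        refine Finset.sum_congr rfl fun j _ => ?_
        rw [add_mulVec, dotProduct_add, smul_mulVec, smul_mulVec, dotProduct_smul,
          dotProduct_smul]
    _ = ∑ l ∈ s, ascEigenvalue (h (a • x + b • y)) l :=
        Finset.sum_congr rfl fun j _ => sum_ascEigenvalue_eq _ hW hAW j

/-- A single eigenvalue is the difference of the Ky Fan sums over `Iic i` and `Iio i`. Both are
concave in `ε`, and concave functions have one-sided derivatives at interior points. -/
theorem exists_hasDerivWithinAt_ascEigenvalue {M N : Matrix n n ℝ}
    (h : ∀ ε : ℝ, (M - ε • N).IsHermitian) (i : Fin (Fintype.card n)) :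
    ∃ b, HasDerivWithinAt (fun ε => ascEigenvalue (h ε) i) b (Set.Ioi 0) 0 := by
  have key : ∀ s : Finset (Fin (Fintype.card n)), (∀ l ∈ s, l ≤ i) → (∀ l ∉ s, i ≤ l) →
      ∃ b, HasDerivWithinAt (fun ε => ∑ l ∈ s, ascEigenvalue (h ε) l) b (Set.Ioi 0) 0 := by
    intro s hs hs'
    have hc := (concaveOn_sum_ascEigenvalue h i s hs hs').neg
    have := (hc.hasDerivWithinAt_rightDeriv_of_mem_interior (x := 0) (by simp)).neg
    rw [neg_neg] at this
    exact ⟨_, this⟩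
  obtain ⟨b₁, h₁⟩ := key (Finset.Iic i) (by simp) (fun l hl => (by simpa using hl : i < l).le)
  obtain ⟨b₂, h₂⟩ := key (Finset.Iio i) (fun l hl => (Finset.mem_Iio.mp hl).le) (by simp)
  refine ⟨b₁ - b₂, (h₁.sub h₂).congr_of_eventuallyEq (.of_forall fun ε => ?_) ?_⟩ <;>
  · rw [Pi.sub_apply, ← Finset.Iio_insert, Finset.sum_insert (by simp)]
    ring

end Spectral

/-! ### Second-order perturbation of the zero eigenvalue of a positive semidefinite matrix. -/

section Perturbation

open Matrix

variable {n m : Type*} [Fintype n] [Fintype m]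

theorem exists_form_le (K : Matrix n n ℝ) : ∃ C, 0 < C ∧ ∀ x, x ⬝ᵥ K *ᵥ x ≤ C * (x ⬝ᵥ x) := by
  -- The summand `1` keeps the constant positive even for `K = 0`; the spectral gap is its inverse.
  refine ⟨1 + ∑ i, ∑ j, |K i j|, ?_, fun x => ?_⟩
  · have : 0 ≤ ∑ i, ∑ j, |K i j| :=
      Finset.sum_nonneg fun i _ => Finset.sum_nonneg fun j _ => abs_nonneg _
    linarith
  have hsq : ∀ i, x i ^ 2 ≤ x ⬝ᵥ x := fun i => by
    rw [pow_two]
    exact Finset.single_le_sum (f := fun i => x i * x i) (fun j _ => mul_self_nonneg _)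
      (Finset.mem_univ i)
  have hle : x ⬝ᵥ K *ᵥ x ≤ (∑ i, ∑ j, |K i j|) * (x ⬝ᵥ x) := by
    change ∑ i, x i * ∑ j, K i j * x j ≤ _
    simp only [Finset.sum_mul, Finset.mul_sum]
    refine Finset.sum_le_sum fun i _ => Finset.sum_le_sum fun j _ => ?_
    have h1 : |x i * x j| ≤ x ⬝ᵥ x := by
      rw [abs_le]
      constructor <;> nlinarith [hsq i, hsq j, sq_nonneg (x i + x j), sq_nonneg (x i - x j)]
    calc x i * (K i j * x j) ≤ |K i j| * |x i * x j| := by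
          rw [← abs_mul]
          exact (le_abs_self _).trans (by rw [show x i * (K i j * x j) = K i j * (x i * x j) by ring])
      _ ≤ _ := mul_le_mul_of_nonneg_left h1 (abs_nonneg _)
  have := dotProduct_self_nonneg_real x
  linarith

theorem dotProduct_mulVec_comm_of_transpose_eq {K : Matrix n n ℝ} (hK : Kᵀ = K) (x y : n → ℝ) :
    x ⬝ᵥ K *ᵥ y = y ⬝ᵥ K *ᵥ x := by
  rw [dotProduct_mulVec, ← mulVec_transpose, hK, dotProduct_comm]

/-- `X` is the Moore-Penrose inverse of the positive semidefinite matrix `A`, whose kernel is the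
range of the isometry `U`. -/
structure IsKernelData [DecidableEq n] [DecidableEq m] (A X : Matrix n n ℝ) (U : Matrix n m ℝ) :
    Prop where
  form_nonneg : ∀ x, 0 ≤ x ⬝ᵥ A *ᵥ x
  symm : Aᵀ = A
  symm_inv : Xᵀ = X
  isometry : Uᵀ * U = 1
  mul_kernel : A * U = 0
  inv_mul_kernel : X * U = 0
  mul_inv : A * X = 1 - U * Uᵀ

namespace IsKernelData

variable [DecidableEq n] [DecidableEq m] {A X B : Matrix n n ℝ} {U : Matrix n m ℝ}

/-- If `X ≤ C` as forms, expanding the nonnegative form of `A` at `z - C⁻¹ X z`, with `A X z = z`,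
gives the gap `C⁻¹`. -/
theorem exists_gap (h : IsKernelData A X U) :
    ∃ μ, 0 < μ ∧ ∀ z, Uᵀ *ᵥ z = 0 → μ * (z ⬝ᵥ z) ≤ z ⬝ᵥ A *ᵥ z := by
  obtain ⟨C, hC, hX⟩ := exists_form_le X
  refine ⟨C⁻¹, inv_pos.mpr hC, fun z hz => ?_⟩
  have h1 : A *ᵥ X *ᵥ z = z := by
    rw [mulVec_mulVec, h.mul_inv, sub_mulVec, one_mulVec, ← mulVec_mulVec, hz, mulVec_zero,
      sub_zero]
  have h2 := h.form_nonneg (z - C⁻¹ • X *ᵥ z)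
  have h3 := hX z
  have h4 := dotProduct_mulVec_comm_of_transpose_eq h.symm (X *ᵥ z) z
  simp only [mulVec_sub, mulVec_smul, dotProduct_sub, sub_dotProduct, smul_dotProduct,
    dotProduct_smul, smul_eq_mul, h1, h4] at h2
  rw [dotProduct_comm (X *ᵥ z) z] at h2
  have h5 : C⁻¹ * (C⁻¹ * (z ⬝ᵥ X *ᵥ z)) ≤ C⁻¹ * (z ⬝ᵥ z) := by
    refine mul_le_mul_of_nonneg_left ?_ (inv_pos.mpr hC).le
    rw [inv_mul_le_iff₀ hC]
    exact h3
  linarith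

theorem kernel_dotProduct (h : IsKernelData A X U) (a : m → ℝ) :
    (U *ᵥ a) ⬝ᵥ (U *ᵥ a) = a ⬝ᵥ a := by
  rw [dotProduct_mulVec, ← mulVec_transpose, mulVec_mulVec, h.isometry, one_mulVec]

theorem transpose_kernel_mul_inv (h : IsKernelData A X U) : Uᵀ * X = 0 := by
  rw [← transpose_inj, transpose_mul, h.symm_inv, transpose_transpose, h.inv_mul_kernel,
    transpose_zero]

theorem kernel_mulVec_dotProduct_inv (h : IsKernelData A X U) (a : m → ℝ) (y : n → ℝ) :
    (U *ᵥ a) ⬝ᵥ (X *ᵥ y) = 0 := by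
  rw [dotProduct_comm, dotProduct_mulVec, ← mulVec_transpose, mulVec_mulVec,
    h.transpose_kernel_mul_inv, zero_mulVec, zero_dotProduct]

theorem mul_inv_dotProduct (h : IsKernelData A X U) {z : n → ℝ} (hz : Uᵀ *ᵥ z = 0) (y : n → ℝ) :
    z ⬝ᵥ A *ᵥ X *ᵥ y = z ⬝ᵥ y := by
  rw [mulVec_mulVec, h.mul_inv, sub_mulVec, one_mulVec, dotProduct_sub, ← mulVec_mulVec,
    dotProduct_mulVec, ← mulVec_transpose, hz, zero_dotProduct, sub_zero]

omit [DecidableEq n] [DecidableEq m] in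
/-- The effective matrix on the kernel, `UᵀBU - ε UᵀBXBU`, as a quadratic form. -/
theorem effective_form (ε : ℝ) (a : m → ℝ) :
    a ⬝ᵥ (Uᵀ * B * U - ε • (Uᵀ * B * X * B * U)) *ᵥ a =
      (U *ᵥ a) ⬝ᵥ B *ᵥ (U *ᵥ a) - ε * ((U *ᵥ a) ⬝ᵥ B *ᵥ X *ᵥ B *ᵥ U *ᵥ a) := by
  rw [sub_mulVec, smul_mulVec, dotProduct_sub, dotProduct_smul, smul_eq_mul]
  simp only [← mulVec_mulVec]
  simp only [dotProduct_mulVec a, vecMul_transpose]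

/-- The correction `w` satisfies `w ⬝ A w = w ⬝ B U a`, so the `ε²` terms combine into the
second-order part of the effective form and only a cubic remainder is left. -/
theorem trial_form (h : IsKernelData A X U) (hB : Bᵀ = B) (ε : ℝ) (a : m → ℝ) {w : n → ℝ}
    (hw : w = X *ᵥ B *ᵥ U *ᵥ a) :
    (U *ᵥ a - ε • w) ⬝ᵥ (A + ε • B) *ᵥ (U *ᵥ a - ε • w) =
      ε * (a ⬝ᵥ (Uᵀ * B * U - ε • (Uᵀ * B * X * B * U)) *ᵥ a) + ε ^ 3 * (w ⬝ᵥ B *ᵥ w) := by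
  have hUw : Uᵀ *ᵥ w = 0 := by
    rw [hw, mulVec_mulVec, h.transpose_kernel_mul_inv, zero_mulVec]
  have h1 := h.mul_inv_dotProduct hUw (B *ᵥ U *ᵥ a)
  rw [effective_form, ← hw]
  rw [← hw] at h1
  have h2 : A *ᵥ U *ᵥ a = 0 := by rw [mulVec_mulVec, h.mul_kernel, zero_mulVec]
  have h3 := dotProduct_mulVec_comm_of_transpose_eq h.symm (U *ᵥ a) w
  have h4 := dotProduct_mulVec_comm_of_transpose_eq hB (U *ᵥ a) w
  rw [h2, dotProduct_zero] at h3
  simp only [mulVec_sub, mulVec_smul, add_mulVec, smul_mulVec, dotProduct_sub, sub_dotProduct,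
    dotProduct_add, smul_dotProduct, dotProduct_smul, smul_eq_mul, h2, dotProduct_zero, h3, h4, h1]
  ring

/-- Upper bound: the corrected trial vectors `U a - ε X B U a` carry the low eigenspaces of the
effective matrix into the big space. -/
theorem ascEigenvalue_le (h : IsKernelData A X U) (hB : Bᵀ = B) (hB0 : ∀ x, 0 ≤ x ⬝ᵥ B *ᵥ x) :
    ∃ C, ∀ ε : ℝ, 0 < ε → ∀ (hL : (A + ε • B).IsHermitian)
      (hH : (Uᵀ * B * U - ε • (Uᵀ * B * X * B * U)).IsHermitian)
      (i : Fin (Fintype.card n)) (j : Fin (Fintype.card m)), (i : ℕ) = j →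
      ascEigenvalue hL i ≤ ε * ascEigenvalue hH j + C * ε ^ 3 := by
  obtain ⟨C, -, hC⟩ := exists_form_le ((X * B * U)ᵀ * B * (X * B * U))
  refine ⟨C, fun ε hε hL hH i j hij => ?_⟩
  obtain ⟨a, ha0, h1, h2⟩ := exists_ne_zero_form_le_and_le_form hH hL (U - ε • (X * B * U)) j i
    hij.le
  obtain ⟨w, hw⟩ : ∃ w, w = X *ᵥ B *ᵥ U *ᵥ a := ⟨_, rfl⟩
  have hT : (U - ε • (X * B * U)) *ᵥ a = U *ᵥ a - ε • w := by
    rw [sub_mulVec, smul_mulVec, hw, mulVec_mulVec, mulVec_mulVec, Matrix.mul_assoc]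
  have hCa := hC a
  have hwa : a ⬝ᵥ ((X * B * U)ᵀ * B * (X * B * U)) *ᵥ a = w ⬝ᵥ B *ᵥ w := by
    rw [← mulVec_mulVec, ← mulVec_mulVec, dotProduct_mulVec, vecMul_transpose, hw]
    simp only [mulVec_mulVec, Matrix.mul_assoc]
  rw [hwa] at hCa
  rw [hT, h.trial_form hB ε a hw] at h2
  -- The correction is orthogonal to the kernel, so it can only lengthen the trial vector; as the
  -- eigenvalue is nonnegative, this helps.
  have hle : a ⬝ᵥ a ≤ (U *ᵥ a - ε • w) ⬝ᵥ (U *ᵥ a - ε • w) := by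
    have h3 := h.kernel_mulVec_dotProduct_inv a (B *ᵥ U *ᵥ a)
    rw [← hw] at h3
    have h4 := dotProduct_self_nonneg_real w
    simp only [dotProduct_sub, sub_dotProduct, smul_dotProduct, dotProduct_smul, smul_eq_mul,
      h3, dotProduct_comm w, h.kernel_dotProduct]
    have : 0 ≤ ε * (ε * (w ⬝ᵥ w)) := by positivity
    linarith
  have hL0 : 0 ≤ ascEigenvalue hL i := ascEigenvalue_nonneg hL (fun x => by
    rw [add_mulVec, smul_mulVec, dotProduct_add, dotProduct_smul, smul_eq_mul]
    exact add_nonneg (h.form_nonneg x) (mul_nonneg hε.le (hB0 x))) i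
  refine le_of_mul_le_mul_right ?_ (dotProduct_self_pos_of_ne_zero ha0)
  have h5 := mul_le_mul_of_nonneg_left hle hL0
  have h6 := mul_le_mul_of_nonneg_left h1 hε.le
  have h7 := mul_le_mul_of_nonneg_left hCa (pow_pos hε 3).le
  linarith

/-- Lower bound: a low vector is split as `x = U a - ε w + z` with `z` orthogonal to the kernel.
Completing the square bounds its form below by that of `z` under `A` plus `ε` times the effective
form of `a`. For small `ε` the gap of `A` absorbs the contribution of `z` to the norm. -/
theorem le_ascEigenvalue (h : IsKernelData A X U) (hB : Bᵀ = B) (hB0 : ∀ x, 0 ≤ x ⬝ᵥ B *ᵥ x) :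
    ∃ C ε₀, 0 < ε₀ ∧ ∀ ε : ℝ, 0 < ε → ε < ε₀ → ∀ (hL : (A + ε • B).IsHermitian)
      (hH : (Uᵀ * B * U - ε • (Uᵀ * B * X * B * U)).IsHermitian)
      (i : Fin (Fintype.card n)) (j : Fin (Fintype.card m)), (i : ℕ) = j →
      ε * ascEigenvalue hH j - C * ε ^ 3 ≤ ascEigenvalue hL i := by
  obtain ⟨μ, hμ, hgap⟩ := h.exists_gap
  obtain ⟨Cw, hCw, hw⟩ := exists_form_le ((X * B * U)ᵀ * (X * B * U))
  obtain ⟨C₁, hC₁, hM⟩ := exists_form_le (Uᵀ * B * U)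
  obtain ⟨C₂, hC₂, hN⟩ := exists_form_le (-(Uᵀ * B * X * B * U))
  obtain ⟨C', hC', hC'0⟩ : ∃ C', C' = C₁ + C₂ ∧ 0 < C' := ⟨_, rfl, by positivity⟩
  -- `C'` bounds the effective eigenvalue for `ε < 1`, and `2 ε C' ≤ μ` lets the gap absorb `2 (z ⬝
  -- z)`. The cubic constant offsets the factor `1 + 2 Cw ε²` from the norm of `x`.
  refine ⟨2 * Cw * C', min 1 (μ / (2 * C')), by positivity,
    fun ε hε hε₀ hL hH i j hij => ?_⟩
  have hε1 : ε < 1 := hε₀.trans_le (min_le_left _ _)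
  have hεμ : 2 * ε * C' ≤ μ := by
    have := hε₀.trans_le (min_le_right _ _)
    rw [lt_div_iff₀ (by positivity)] at this
    linarith
  have hl : ascEigenvalue hH j ≤ C' := by
    obtain ⟨a, ha0, -, ha⟩ := exists_ne_zero_form_le_and_le_form hH hH 1 j j le_rfl
    rw [one_mulVec, sub_mulVec, smul_mulVec, dotProduct_sub, dotProduct_smul, smul_eq_mul] at ha
    refine le_of_mul_le_mul_right ?_ (dotProduct_self_pos_of_ne_zero ha0)
    have h1 := hM a
    have h2 := hN a
    rw [neg_mulVec, dotProduct_neg] at h2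
    have h3 : ε * -(a ⬝ᵥ (Uᵀ * B * X * B * U) *ᵥ a) ≤ 1 * (C₂ * (a ⬝ᵥ a)) := by
      have := dotProduct_self_nonneg_real a
      exact (mul_le_mul_of_nonneg_left h2 hε.le).trans
        (mul_le_mul_of_nonneg_right hε1.le (by positivity))
    rw [hC']
    linarith
  obtain ⟨x, hx0, hx, ha⟩ := exists_ne_zero_form_le_and_le_form hL hH Uᵀ i j hij.ge
  have hL0 : 0 ≤ ascEigenvalue hL i := ascEigenvalue_nonneg hL (fun x => by
    rw [add_mulVec, smul_mulVec, dotProduct_add, dotProduct_smul, smul_eq_mul]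
    exact add_nonneg (h.form_nonneg x) (mul_nonneg hε.le (hB0 x))) i
  generalize ascEigenvalue hH j = l at *
  generalize ascEigenvalue hL i = L at *
  -- A nonpositive lower bound is trivial; otherwise its sign permits multiplying it by the upper
  -- bound for `x ⬝ x`.
  rcases le_or_gt (ε * l - 2 * Cw * C' * ε ^ 3) 0 with hneg | hpos
  · exact hneg.trans hL0
  obtain ⟨a, hae⟩ : ∃ a, a = Uᵀ *ᵥ x := ⟨_, rfl⟩
  obtain ⟨u, hu⟩ : ∃ u, u = U *ᵥ a := ⟨_, rfl⟩
  obtain ⟨w, hwe⟩ : ∃ w, w = X *ᵥ B *ᵥ U *ᵥ a := ⟨_, rfl⟩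
  obtain ⟨z, hz⟩ : ∃ z, z = x - u + ε • w := ⟨_, rfl⟩
  have hxe : x = u + (z - ε • w) := by rw [hz]; abel
  have hUw : Uᵀ *ᵥ w = 0 := by
    rw [hwe, mulVec_mulVec, h.transpose_kernel_mul_inv, zero_mulVec]
  have hUz : Uᵀ *ᵥ z = 0 := by
    rw [hz, mulVec_add, mulVec_sub, mulVec_smul, hUw, hu, mulVec_mulVec, h.isometry, one_mulVec,
      hae, sub_self, smul_zero, add_zero]
  rw [← hae, effective_form, ← hwe, ← hu] at ha
  have hAu : A *ᵥ u = 0 := by rw [hu, mulVec_mulVec, h.mul_kernel, zero_mulVec]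
  have e1 : w ⬝ᵥ A *ᵥ w = w ⬝ᵥ B *ᵥ u := by
    have := h.mul_inv_dotProduct hUw (B *ᵥ u)
    rwa [hu, ← hwe, ← hu] at this
  have e2 : z ⬝ᵥ A *ᵥ w = z ⬝ᵥ B *ᵥ u := by
    have := h.mul_inv_dotProduct hUz (B *ᵥ u)
    rwa [hu, ← hwe, ← hu] at this
  have e3 := dotProduct_mulVec_comm_of_transpose_eq h.symm u z
  have e4 := dotProduct_mulVec_comm_of_transpose_eq h.symm u w
  have e5 := dotProduct_mulVec_comm_of_transpose_eq h.symm w z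
  have e6 := dotProduct_mulVec_comm_of_transpose_eq hB u w
  have e7 := dotProduct_mulVec_comm_of_transpose_eq hB u z
  rw [hAu, dotProduct_zero] at e3 e4
  have hform : z ⬝ᵥ A *ᵥ z + ε * (u ⬝ᵥ B *ᵥ u - ε * (u ⬝ᵥ B *ᵥ w)) ≤
      x ⬝ᵥ (A + ε • B) *ᵥ x := by
    -- This square, the `B`-form of the part of `x` off the kernel, is the only term dropped.
    have hy := mul_nonneg hε.le (hB0 (z - ε • w))
    rw [hxe]
    simp only [mulVec_add, mulVec_sub, mulVec_smul, add_mulVec, smul_mulVec, dotProduct_sub,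
      sub_dotProduct, add_dotProduct, dotProduct_add, smul_dotProduct, dotProduct_smul,
      smul_eq_mul, hAu, dotProduct_zero, e1, e2, e3, e4, e5, e6, e7] at hy ⊢
    linarith
  have o1 : u ⬝ᵥ w = 0 := by rw [hu, hwe]; exact h.kernel_mulVec_dotProduct_inv _ _
  have o2 : u ⬝ᵥ z = 0 := by
    rw [dotProduct_comm, hu, dotProduct_mulVec, ← mulVec_transpose, hUz, zero_dotProduct]
  have huu : u ⬝ᵥ u = a ⬝ᵥ a := by rw [hu, h.kernel_dotProduct]
  have hww : w ⬝ᵥ w ≤ Cw * (a ⬝ᵥ a) := by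
    have := hw a
    rwa [← mulVec_mulVec, dotProduct_mulVec, vecMul_transpose, ← mulVec_mulVec, ← mulVec_mulVec,
      ← hwe] at this
  have hxx : x ⬝ᵥ x ≤ (1 + 2 * Cw * ε ^ 2) * (a ⬝ᵥ a) + 2 * (z ⬝ᵥ z) := by
    have hy := dotProduct_self_nonneg_real (z + ε • w)
    have hww' := mul_le_mul_of_nonneg_left hww (sq_nonneg ε)
    rw [hxe]
    simp only [add_dotProduct, sub_dotProduct, smul_dotProduct, dotProduct_add, dotProduct_sub,
      dotProduct_smul, smul_eq_mul, dotProduct_comm w u, dotProduct_comm z u,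
      dotProduct_comm w z, o1, o2, huu] at hy ⊢
    linarith
  have hzz := dotProduct_self_nonneg_real z
  have haa := dotProduct_self_nonneg_real a
  refine le_of_mul_le_mul_right ?_ (dotProduct_self_pos_of_ne_zero hx0)
  have hgz := hgap z hUz
  have hg : ε * l - 2 * Cw * C' * ε ^ 3 ≤ ε * C' := by
    have : 0 ≤ 2 * Cw * C' * ε ^ 3 := by positivity
    have := mul_le_mul_of_nonneg_left hl hε.le
    linarith
  have s1 := mul_le_mul_of_nonneg_left hxx hpos.le
  have s2 : (ε * l - 2 * Cw * C' * ε ^ 3) * (2 * (z ⬝ᵥ z)) ≤ μ * (z ⬝ᵥ z) := by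
    refine (mul_le_mul_of_nonneg_right hg (by positivity)).trans ?_
    have := mul_le_mul_of_nonneg_right hεμ hzz
    linarith
  have s3 : (ε * l - 2 * Cw * C' * ε ^ 3) * (1 + 2 * Cw * ε ^ 2) ≤ ε * l := by
    have := mul_le_mul_of_nonneg_right hg (by positivity : 0 ≤ 2 * Cw * ε ^ 2)
    linarith
  have s4 := mul_le_mul_of_nonneg_right s3 haa
  have s5 := mul_le_mul_of_nonneg_left ha hε.le
  linarith

end IsKernelData

end Perturbation

/-! ### Graph Laplacians, their pseudoinverses and information centrality. -/

section Laplacian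

open Matrix

namespace WeightedGraph

variable {V : Type*} [Fintype V] [DecidableEq V] (G : WeightedGraph V)

omit [Fintype V] [DecidableEq V] in
theorem weight_self (u : V) : G.weight u u = 0 :=
  G.weight_eq_zero u u (G.graph.irrefl)

omit [Fintype V] [DecidableEq V] in
theorem weight_nonneg (u v : V) : 0 ≤ G.weight u v := by
  by_cases h : G.graph.Adj u v
  · exact (G.weight_pos u v h).le
  · exact (G.weight_eq_zero u v h).ge

theorem lap_eq_sub : G.lap = diagonal (fun r => ∑ u, G.weight r u) - of G.weight := by
  ext r s
  by_cases h : r = s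
  · subst h
    simp [lap, G.weight_self]
  · simp [lap, h]

theorem lap_mulVec_apply (x : V → ℝ) (r : V) :
    (G.lap *ᵥ x) r = ∑ u, G.weight r u * (x r - x u) := by
  rw [lap_eq_sub, sub_mulVec, Pi.sub_apply, mulVec_diagonal, Finset.sum_mul]
  simp only [mulVec, dotProduct, of_apply]
  rw [← Finset.sum_sub_distrib]
  exact Finset.sum_congr rfl fun u _ => by ring

theorem lap_form (x : V → ℝ) :
    2 * (x ⬝ᵥ G.lap *ᵥ x) = ∑ r, ∑ u, G.weight r u * (x r - x u) ^ 2 := by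
  have h1 : x ⬝ᵥ G.lap *ᵥ x = ∑ r, ∑ u, G.weight r u * (x r * (x r - x u)) := by
    simp only [dotProduct, lap_mulVec_apply, Finset.mul_sum]
    exact Finset.sum_congr rfl fun r _ => Finset.sum_congr rfl fun u _ => by ring
  have h2 : x ⬝ᵥ G.lap *ᵥ x = ∑ r, ∑ u, G.weight r u * (x u * (x u - x r)) := by
    rw [h1, Finset.sum_comm]
    exact Finset.sum_congr rfl fun r _ => Finset.sum_congr rfl fun u _ => by
      rw [G.weight_symm]
  rw [two_mul]
  nth_rewrite 1 [h1]
  rw [h2, ← Finset.sum_add_distrib]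
  refine Finset.sum_congr rfl fun r _ => ?_
  rw [← Finset.sum_add_distrib]
  exact Finset.sum_congr rfl fun u _ => by ring

theorem lap_form_nonneg (x : V → ℝ) : 0 ≤ x ⬝ᵥ G.lap *ᵥ x := by
  have h : 0 ≤ ∑ r, ∑ u, G.weight r u * (x r - x u) ^ 2 :=
    Finset.sum_nonneg fun r _ => Finset.sum_nonneg fun u _ =>
      mul_nonneg (G.weight_nonneg r u) (sq_nonneg _)
  rw [← G.lap_form] at h
  linarith

variable {G} in
theorem eq_of_lap_form_eq_zero (hG : G.graph.Connected) {x : V → ℝ}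
    (hx : x ⬝ᵥ G.lap *ᵥ x = 0) (u v : V) : x u = x v := by
  have hnn : ∀ r u, 0 ≤ G.weight r u * (x r - x u) ^ 2 := fun r u =>
    mul_nonneg (G.weight_nonneg r u) (sq_nonneg _)
  have h := G.lap_form x
  rw [hx, mul_zero, eq_comm,
    Finset.sum_eq_zero_iff_of_nonneg fun r _ => Finset.sum_nonneg fun u _ => hnn r u] at h
  have hadj : ∀ a b, G.graph.Adj a b → x a = x b := by
    intro a b hab
    have h1 := h a (Finset.mem_univ a)
    rw [Finset.sum_eq_zero_iff_of_nonneg fun u _ => hnn a u] at h1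
    have h2 := h1 b (Finset.mem_univ b)
    rw [mul_eq_zero, or_iff_right (G.weight_pos a b hab).ne'] at h2
    exact sub_eq_zero.mp (pow_eq_zero_iff two_ne_zero |>.mp h2)
  obtain ⟨p⟩ := hG.preconnected u v
  induction p with
  | nil => rfl
  | cons hab _ ih => exact (hadj _ _ hab).trans ih

theorem lap_transpose : G.lapᵀ = G.lap := G.lap_isHermitian

theorem lap_mulVec_const (c : ℝ) : (G.lap *ᵥ fun _ => c) = 0 := by
  ext r
  simp [lap_mulVec_apply]

/-- The Moore-Penrose inverse of the Laplacian. -/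
noncomputable def lapPinv : Matrix V V ℝ := symmPinv G.lap_isHermitian

theorem lapPinv_transpose : G.lapPinvᵀ = G.lapPinv := by
  simp [lapPinv, symmPinv, transpose_mul, Matrix.mul_assoc]

theorem lapPinv_isMoorePenroseInverse : IsMoorePenroseInverse G.lap G.lapPinv :=
  symmPinv_isMoorePenroseInverse G.lap_isHermitian

theorem lap_mul_lapPinv_eq_lapPinv_mul_lap : G.lap * G.lapPinv = G.lapPinv * G.lap := by
  have h := G.lapPinv_isMoorePenroseInverse.symm_left
  rw [transpose_mul, G.lap_transpose, G.lapPinv_transpose] at h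
  exact h.symm

theorem lapPinv_mulVec_const (c : ℝ) : (G.lapPinv *ᵥ fun _ => c) = 0 := by
  rw [← G.lapPinv_isMoorePenroseInverse.self_mul_mul, Matrix.mul_assoc,
    G.lap_mul_lapPinv_eq_lapPinv_mul_lap, ← mulVec_mulVec, ← mulVec_mulVec, lap_mulVec_const,
    mulVec_zero, mulVec_zero]

-- The complementary projection `P` has columns in `ker L`, hence constant columns. By symmetry all
-- its entries are equal, and `P 1 = 1` fixes their value.
variable {G} in
theorem lap_mul_lapPinv (hG : G.graph.Connected) :
    G.lap * G.lapPinv = 1 - of fun _ _ => (Fintype.card V : ℝ)⁻¹ := by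
  have hne : (Fintype.card V : ℝ) ≠ 0 := by
    have := hG.nonempty
    exact_mod_cast Fintype.card_ne_zero
  obtain ⟨P, hP⟩ : ∃ P, P = 1 - G.lap * G.lapPinv := ⟨_, rfl⟩
  have hPs : Pᵀ = P := by
    rw [hP, transpose_sub, transpose_one, G.lapPinv_isMoorePenroseInverse.symm_left]
  have hLP : G.lap * P = 0 := by
    rw [hP, G.lap_mul_lapPinv_eq_lapPinv_mul_lap, Matrix.mul_sub, Matrix.mul_one,
      ← Matrix.mul_assoc, G.lapPinv_isMoorePenroseInverse.mul_mul_self, sub_self]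
  have hcol : ∀ a b j, P a j = P b j := by
    intro a b j
    refine eq_of_lap_form_eq_zero hG (x := fun r => P r j) ?_ a b
    have : (G.lap *ᵥ fun r => P r j) = 0 := by
      ext r
      exact congrFun (congrFun hLP r) j
    rw [this, dotProduct_zero]
  have hconst : ∀ a b c d, P a b = P c d := by
    intro a b c d
    calc P a b = P c b := hcol _ _ _
      _ = P b c := congrFun (congrFun hPs b) c
      _ = P d c := hcol _ _ _
      _ = P c d := congrFun (congrFun hPs c) d
  have hP1 : P *ᵥ (fun _ => (1 : ℝ)) = fun _ => 1 := by
    rw [hP, sub_mulVec, one_mulVec, ← mulVec_mulVec, lapPinv_mulVec_const, mulVec_zero, sub_zero]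
  have hval : P = of fun _ _ => (Fintype.card V : ℝ)⁻¹ := by
    ext a b
    have h := congrFun hP1 a
    simp only [mulVec, dotProduct, mul_one] at h
    rw [Finset.sum_congr rfl fun j _ => hconst a j a b] at h
    simp only [Finset.sum_const, Finset.card_univ, nsmul_eq_mul] at h
    rw [of_apply]
    field_simp
    linarith
  rw [← hval, hP]
  abel

theorem lapPinv_apply_self_nonneg (r : V) : 0 ≤ G.lapPinv r r := by
  have h := G.lap_form_nonneg (G.lapPinv *ᵥ Pi.single r 1)
  rw [mulVec_mulVec, dotProduct_comm, dotProduct_mulVec, ← mulVec_transpose, mulVec_mulVec,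
    G.lapPinv_transpose, ← Matrix.mul_assoc, G.lapPinv_isMoorePenroseInverse.self_mul_mul] at h
  simpa using h

-- `L` acts on the orthogonal complement of the constants, and `J` acts on the constants as the
-- scalar `m`; so the inverse of the sum is `L†` plus `1/m` times the projection `J/m`.
variable {G} in
theorem infoMatrix_eq (hG : G.graph.Connected) :
    G.infoMatrix = G.lapPinv + of fun _ _ => ((Fintype.card V : ℝ)⁻¹) ^ 2 := by
  have hne : (Fintype.card V : ℝ) ≠ 0 := by
    have := hG.nonempty
    exact_mod_cast Fintype.card_ne_zero
  refine inv_eq_right_inv ?_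
  rw [Matrix.add_mul, Matrix.mul_add, Matrix.mul_add, lap_mul_lapPinv hG]
  have h1 : G.lap * (of fun _ _ : V => ((Fintype.card V : ℝ)⁻¹) ^ 2) = 0 := by
    ext a b
    exact congrFun (G.lap_mulVec_const _) a
  have h2 : (of fun _ _ : V => (1 : ℝ)) * G.lapPinv = 0 := by
    rw [← transpose_inj, transpose_mul, G.lapPinv_transpose]
    ext a b
    exact congrFun (G.lapPinv_mulVec_const 1) a
  have h3 : (of fun _ _ : V => (1 : ℝ)) * (of fun _ _ : V => ((Fintype.card V : ℝ)⁻¹) ^ 2) =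
      of fun _ _ => (Fintype.card V : ℝ)⁻¹ := by
    ext a b
    simp [mul_apply]
    field_simp
  rw [h1, h2, h3]
  abel

-- The constant shift of `infoMatrix` cancels in `c_rr + c_vv - 2 c_rv`, and the rows of `L†` sum to
-- zero, so averaging over `v` leaves only the diagonal entry and the trace.
variable {G} in
theorem infoCentrality_eq (hG : G.graph.Connected) (r : V) :
    G.infoCentrality r = (G.lapPinv r r + G.lapPinv.trace / Fintype.card V)⁻¹ := by
  have hne : (Fintype.card V : ℝ) ≠ 0 := by
    have := hG.nonempty
    exact_mod_cast Fintype.card_ne_zero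
  have hrow : ∑ s, G.lapPinv r s = 0 := by
    have := congrFun (G.lapPinv_mulVec_const 1) r
    simpa [mulVec, dotProduct] using this
  have hs : ∀ s, (G.information r s)⁻¹ = G.lapPinv r r + G.lapPinv s s - 2 * G.lapPinv r s := by
    intro s
    rw [information, inv_inv, infoMatrix_eq hG]
    simp
    ring
  rw [infoCentrality, Finset.sum_congr rfl fun s _ => hs s, Finset.sum_sub_distrib,
    Finset.sum_add_distrib, ← Finset.mul_sum, hrow, Finset.sum_const, Finset.card_univ,
    nsmul_eq_mul, trace]
  congr 1
  simp only [diag_apply]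
  field_simp
  ring

variable {G} in
theorem IsMaxInfoCentrality.lapPinv_le (hG : G.graph.Connected) {r : V}
    (hr : G.IsMaxInfoCentrality r) (v : V) : G.lapPinv r r ≤ G.lapPinv v v := by
  have hcard : (0 : ℝ) < Fintype.card V := by
    have := hG.nonempty
    exact_mod_cast Fintype.card_pos
  have h0 : 0 ≤ G.lapPinv.trace := Finset.sum_nonneg fun i _ => G.lapPinv_apply_self_nonneg i
  -- With zero trace the whole diagonal vanishes, and centrality, being `0⁻¹`, says nothing. With
  -- positive trace both denominators are positive and inversion reverses the order.
  rcases h0.eq_or_lt with h0 | h0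
  · have h := (Finset.sum_eq_zero_iff_of_nonneg fun i _ => G.lapPinv_apply_self_nonneg i).mp h0.symm
    exact ((h r (Finset.mem_univ r)).trans (h v (Finset.mem_univ v)).symm).le
  · have hv := hr v
    have hpos := div_pos h0 hcard
    rw [infoCentrality_eq hG, infoCentrality_eq hG, inv_le_inv₀
      (add_pos_of_nonneg_of_pos (G.lapPinv_apply_self_nonneg v) hpos)
      (add_pos_of_nonneg_of_pos (G.lapPinv_apply_self_nonneg r) hpos)] at hv
    linarith

end WeightedGraph

end Laplacian

/-! ### The supra-Laplacian: effective matrices, approximations and positivity. -/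

section Network

open Matrix

theorem ascEigenvalue_congr {n : Type*} [Fintype n] [DecidableEq n] {A B : Matrix n n ℝ}
    (h : A = B) (hA : A.IsHermitian) (hB : B.IsHermitian) :
    ascEigenvalue hA = ascEigenvalue hB := by
  subst h
  rfl

namespace NetworkOfNetworks

variable {D : ℕ} {V : Fin D → Type*} [∀ k, Fintype (V k)] [∀ k, DecidableEq (V k)]

omit [∀ k, DecidableEq (V k)] in
theorem blockDiagonal'_mulVec_apply (M : ∀ k, Matrix (V k) (V k) ℝ) (x : (Σ k, V k) → ℝ)
    (k : Fin D) (v : V k) :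
    (blockDiagonal' M *ᵥ x) ⟨k, v⟩ = (M k *ᵥ fun u => x ⟨k, u⟩) v := by
  rw [mulVec, dotProduct, Fintype.sum_sigma, Finset.sum_eq_single k]
  · simp [mulVec, dotProduct]
  · intro l _ hl
    exact Finset.sum_eq_zero fun u _ => by rw [blockDiagonal'_apply_ne _ _ _ hl.symm, zero_mul]
  · simp

omit [∀ k, DecidableEq (V k)] in
theorem blockDiagonal'_form (M : ∀ k, Matrix (V k) (V k) ℝ) (x : (Σ k, V k) → ℝ) :
    x ⬝ᵥ blockDiagonal' M *ᵥ x =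
      ∑ k, (fun u => x ⟨k, u⟩) ⬝ᵥ M k *ᵥ fun u => x ⟨k, u⟩ := by
  rw [dotProduct, Fintype.sum_sigma]
  simp only [blockDiagonal'_mulVec_apply]
  rfl

variable (S : NetworkOfNetworks D V) (s : ∀ k, V k)

/-- The isometry of `ℝ^D` onto the kernel of the block diagonal Laplacian. -/
noncomputable def kernelMatrix (V : Fin D → Type*) [∀ k, Fintype (V k)] :
    Matrix (Σ k, V k) (Fin D) ℝ :=
  fun p l => if p.1 = l then (√(Fintype.card (V l)))⁻¹ else 0

/-- The evaluation of a vector at the connecting nodes. -/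
def evalMatrix : Matrix (Fin D) (Σ k, V k) ℝ :=
  (1 : Matrix (Σ k, V k) (Σ k, V k) ℝ).submatrix (fun l => ⟨l, s l⟩) id

theorem evalMatrix_mulVec (x : (Σ k, V k) → ℝ) (l : Fin D) :
    (evalMatrix s *ᵥ x) l = x ⟨l, s l⟩ := by
  simp [evalMatrix, mulVec, dotProduct, one_apply]

theorem evalMatrix_mul {m : Type*} (K : Matrix (Σ k, V k) m ℝ) :
    evalMatrix s * K = K.submatrix (fun l => ⟨l, s l⟩) id := by
  ext l j
  exact evalMatrix_mulVec s (fun p => K p j) l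

/-- This factorization confines the choice of connecting nodes to the evaluation matrix. -/
theorem connectingGraph_lap :
    (S.connectingGraph s).lap = (evalMatrix s)ᵀ * S.con.lap * evalMatrix s := by
  ext ⟨k, v⟩ ⟨l, u⟩
  have hE : ∀ (j : Fin D) (p : Σ k, V k), evalMatrix s j p =
      if j = p.1 then (if p.2 = s p.1 then 1 else 0) else 0 := by
    rintro j ⟨a, b⟩
    by_cases hj : j = a
    · subst hj
      simp [evalMatrix, one_apply, eq_comm]
    · simp [evalMatrix, one_apply, hj]
  have hR : ((evalMatrix s)ᵀ * S.con.lap * evalMatrix s) ⟨k, v⟩ ⟨l, u⟩ =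
      if v = s k ∧ u = s l then S.con.lap k l else 0 := by
    simp only [mul_apply, transpose_apply, hE]
    by_cases h1 : v = s k <;> by_cases h2 : u = s l <;> simp [h1, h2]
  rw [hR]
  by_cases hkl : k = l
  · subst hkl
    by_cases huv : v = u
    · subst huv
      simp only [WeightedGraph.lap, if_true, and_self, connectingGraph, Fintype.sum_sigma]
      by_cases hv : v = s k <;> simp [hv]
    · have h1 : ¬ (v = s k ∧ u = s k) := fun h => huv (h.1.trans h.2.symm)
      have h2 : (⟨k, v⟩ : Σ k, V k) ≠ ⟨k, u⟩ := by simpa using huv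
      simp [WeightedGraph.lap, h2, connectingGraph, h1]
  · have h2 : (⟨k, v⟩ : Σ k, V k) ≠ ⟨l, u⟩ := fun h => hkl (congrArg Sigma.fst h)
    simp only [WeightedGraph.lap, if_neg h2, if_neg hkl, connectingGraph]
    split_ifs <;> simp

theorem isKernelData :
    IsKernelData (blockDiagonal' fun k => (S.sub k).lap) (blockDiagonal' fun k => (S.sub k).lapPinv)
      (kernelMatrix V) := by
  have hcard : ∀ k, (0 : ℝ) < Fintype.card (V k) := by
    intro k
    have := (S.connected k).nonempty
    exact_mod_cast Fintype.card_pos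
  have hblock : ∀ M : ∀ k, Matrix (V k) (V k) ℝ, (∀ k c, (M k *ᵥ fun _ => c) = 0) →
      blockDiagonal' M * kernelMatrix V = 0 := by
    intro M hM
    ext ⟨k, v⟩ l
    exact (blockDiagonal'_mulVec_apply M (fun p => kernelMatrix V p l) k v).trans
      (congrFun (hM k (if k = l then (√(Fintype.card (V l)))⁻¹ else 0)) v)
  refine ⟨fun x => ?_, ?_, ?_, ?_, hblock _ fun k => (S.sub k).lap_mulVec_const,
    hblock _ fun k => (S.sub k).lapPinv_mulVec_const, ?_⟩
  · rw [blockDiagonal'_form]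
    exact Finset.sum_nonneg fun k _ => (S.sub k).lap_form_nonneg _
  · rw [blockDiagonal'_transpose]
    simp only [WeightedGraph.lap_transpose]
  · rw [blockDiagonal'_transpose]
    simp only [WeightedGraph.lapPinv_transpose]
  · ext k l
    simp only [mul_apply, transpose_apply, Fintype.sum_sigma, kernelMatrix]
    by_cases hkl : k = l
    · subst hkl
      have := hcard k
      rw [Finset.sum_eq_single k (fun j _ hj => by simp [hj]) (by simp)]
      simp only [if_true, Finset.sum_const, Finset.card_univ, nsmul_eq_mul, one_apply_eq]
      rw [← mul_inv, Real.mul_self_sqrt this.le, mul_inv_cancel₀ this.ne']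
    · rw [one_apply_ne hkl]
      refine Finset.sum_eq_zero fun j _ => Finset.sum_eq_zero fun v _ => ?_
      by_cases hj : j = k
      · subst hj
        simp [hkl]
      · simp [hj]
  · rw [← blockDiagonal'_mul]
    simp only [fun k => WeightedGraph.lap_mul_lapPinv (S.connected k)]
    ext ⟨k, v⟩ ⟨l, u⟩
    rw [Matrix.sub_apply, mul_apply]
    simp only [transpose_apply, kernelMatrix]
    rw [Finset.sum_eq_single k (fun j _ hj => by simp [hj.symm]) (by simp)]
    by_cases hkl : k = l
    · subst hkl
      rw [blockDiagonal'_apply_eq, if_pos rfl, ← mul_inv, Real.mul_self_sqrt (hcard k).le]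
      simp [one_apply]
    · have h2 : (⟨k, v⟩ : Σ k, V k) ≠ ⟨l, u⟩ := fun h => hkl (congrArg Sigma.fst h)
      rw [blockDiagonal'_apply_ne _ _ _ hkl, one_apply_ne h2]
      simp [Ne.symm hkl]

/-- The scaling of `ℝ^D` by the inverse square roots of the sizes of the subgraphs. -/
noncomputable def sizeScaling (V : Fin D → Type*) [∀ k, Fintype (V k)] : Matrix (Fin D) (Fin D) ℝ :=
  diagonal fun k => (√(Fintype.card (V k)))⁻¹

/-- Kernel vectors are constant on each subgraph, so their values at the connecting nodes do not
depend on `s`. This is why the first order is blind to the choice. -/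
theorem evalMatrix_mul_kernelMatrix : evalMatrix s * kernelMatrix V = sizeScaling V := by
  rw [evalMatrix_mul]
  ext k l
  by_cases hkl : k = l
  · subst hkl
    simp [kernelMatrix, sizeScaling]
  · simp [kernelMatrix, sizeScaling, hkl]

/-- The first-order coefficient matrix. -/
noncomputable def firstOrderMatrix : Matrix (Fin D) (Fin D) ℝ :=
  (sizeScaling V)ᵀ * S.con.lap * sizeScaling V

/-- The second-order coefficient matrix, up to sign. -/
noncomputable def secondOrderMatrix : Matrix (Fin D) (Fin D) ℝ :=
  (S.con.lap * sizeScaling V)ᵀ * diagonal (fun k => (S.sub k).lapPinv (s k) (s k)) *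
    (S.con.lap * sizeScaling V)

theorem kernelMatrix_mul_lap_mul :
    (kernelMatrix V)ᵀ * (S.connectingGraph s).lap * kernelMatrix V = S.firstOrderMatrix := by
  rw [connectingGraph_lap, firstOrderMatrix, ← evalMatrix_mul_kernelMatrix s, transpose_mul]
  simp only [Matrix.mul_assoc]

/-- There is one connecting node per block, so no off-diagonal entries survive; for `L_k†` this
leaves exactly the diagonal entries that centrality controls. -/
theorem evalMatrix_mul_blockDiagonal' (M : ∀ k, Matrix (V k) (V k) ℝ) :
    evalMatrix s * blockDiagonal' M * (evalMatrix s)ᵀ = diagonal fun k => M k (s k) (s k) := by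
  have h : ∀ K : Matrix (Fin D) (Σ k, V k) ℝ, K * (evalMatrix s)ᵀ =
      K.submatrix id (fun l => ⟨l, s l⟩) := by
    intro K
    rw [← transpose_inj, transpose_mul, transpose_transpose, evalMatrix_mul]
    rfl
  rw [h, evalMatrix_mul]
  ext k l
  by_cases hkl : k = l
  · subst hkl
    simp
  · simp [hkl, blockDiagonal'_apply_ne]

theorem kernelMatrix_mul_lap_mul_lapPinv_mul :
    (kernelMatrix V)ᵀ * (S.connectingGraph s).lap * (blockDiagonal' fun k => (S.sub k).lapPinv) *
      (S.connectingGraph s).lap * kernelMatrix V = S.secondOrderMatrix s := by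
  rw [connectingGraph_lap, secondOrderMatrix, ← evalMatrix_mul_blockDiagonal' s,
    ← evalMatrix_mul_kernelMatrix s, transpose_mul, transpose_mul, S.con.lap_transpose]
  simp only [Matrix.mul_assoc]

omit [∀ k, DecidableEq (V k)] in
theorem firstOrderMatrix_isHermitian : S.firstOrderMatrix.IsHermitian := by
  rw [IsHermitian, conjTranspose_eq_transpose_of_trivial, firstOrderMatrix]
  simp only [transpose_mul, transpose_transpose, S.con.lap_transpose, Matrix.mul_assoc]

theorem effectiveMatrix_isHermitian (ε : ℝ) :
    (S.firstOrderMatrix - ε • S.secondOrderMatrix s).IsHermitian := by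
  refine S.firstOrderMatrix_isHermitian.sub ?_
  rw [IsHermitian, conjTranspose_eq_transpose_of_trivial, secondOrderMatrix]
  simp only [transpose_smul, transpose_mul, transpose_transpose, diagonal_transpose,
    Matrix.mul_assoc]

theorem secondOrderMatrix_form (a : Fin D → ℝ) :
    a ⬝ᵥ S.secondOrderMatrix s *ᵥ a = ∑ k, (S.sub k).lapPinv (s k) (s k) *
      ((S.con.lap * sizeScaling V) *ᵥ a) k ^ 2 :=
  dotProduct_mulVec_eq_sum rfl a

/-- The eigenvalues of the effective `D × D` matrix. -/
noncomputable def effectiveEigenvalue (i : Fin D) (ε : ℝ) : ℝ :=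
  ascEigenvalue (S.effectiveMatrix_isHermitian s ε) (Fin.cast (Fintype.card_fin D).symm i)

theorem effectiveEigenvalue_zero (i : Fin D) :
    S.effectiveEigenvalue s i 0 =
      ascEigenvalue S.firstOrderMatrix_isHermitian (Fin.cast (Fintype.card_fin D).symm i) := by
  rw [effectiveEigenvalue, ascEigenvalue_congr (by rw [zero_smul, sub_zero])]

theorem eigenvalue_sub_effectiveEigenvalue_isBigO (i : Fin D) :
    (fun ε => S.eigenvalue s i ε - ε * S.effectiveEigenvalue s i ε) =O[𝓝[>] 0]
      fun ε : ℝ => ε ^ 3 := by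
  have hB := (S.connectingGraph s).lap_transpose
  have hB0 := (S.connectingGraph s).lap_form_nonneg
  obtain ⟨C₁, h₁⟩ := S.isKernelData.ascEigenvalue_le hB hB0
  obtain ⟨C₂, ε₀, hε₀, h₂⟩ := S.isKernelData.le_ascEigenvalue hB hB0
  rw [S.kernelMatrix_mul_lap_mul_lapPinv_mul s, S.kernelMatrix_mul_lap_mul s] at h₁ h₂
  refine IsBigO.of_bound (max C₁ C₂) ?_
  filter_upwards [Ioo_mem_nhdsGT hε₀] with ε hε
  have u : S.eigenvalue s i ε ≤ ε * S.effectiveEigenvalue s i ε + C₁ * ε ^ 3 :=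
    h₁ ε hε.1 (S.supraLaplacian_isHermitian s ε) (S.effectiveMatrix_isHermitian s ε)
      (Fin.castLE (le_card s) i) (Fin.cast (Fintype.card_fin D).symm i) rfl
  have l : ε * S.effectiveEigenvalue s i ε - C₂ * ε ^ 3 ≤ S.eigenvalue s i ε :=
    h₂ ε hε.1 hε.2 (S.supraLaplacian_isHermitian s ε) (S.effectiveMatrix_isHermitian s ε)
      (Fin.castLE (le_card s) i) (Fin.cast (Fintype.card_fin D).symm i) rfl
  have h3 : 0 < ε ^ 3 := pow_pos hε.1 3
  rw [Real.norm_eq_abs, Real.norm_eq_abs, abs_of_pos h3, abs_le]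
  have m1 := mul_le_mul_of_nonneg_right (le_max_left C₁ C₂) h3.le
  have m2 := mul_le_mul_of_nonneg_right (le_max_right C₁ C₂) h3.le
  constructor <;> linarith

theorem exists_hasDerivWithinAt_effectiveEigenvalue (i : Fin D) :
    ∃ b, HasDerivWithinAt (S.effectiveEigenvalue s i) b (Set.Ioi 0) 0 :=
  exists_hasDerivWithinAt_ascEigenvalue _ _

/-- The expansion `h(ε) = h(0) + b ε + o(ε)` of the effective eigenvalue gains one order from the
prefactor `ε`, and the `O(ε³)` error is negligible. -/
theorem eigenvalue_sub_isLittleO {i : Fin D} {b : ℝ}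
    (hb : HasDerivWithinAt (S.effectiveEigenvalue s i) b (Set.Ioi 0) 0) :
    (fun ε => S.eigenvalue s i ε - (S.effectiveEigenvalue s i 0 * ε + b * ε ^ 2)) =o[𝓝[>] 0]
      fun ε : ℝ => ε ^ 2 := by
  have h1 : (fun ε : ℝ => ε ^ 3) =o[𝓝[>] 0] fun ε : ℝ => ε ^ 2 :=
    (isLittleO_pow_pow (by norm_num : 2 < 3)).mono nhdsWithin_le_nhds
  have h2 := hasDerivWithinAt_iff_isLittleO.mp hb
  have h3 := (isBigO_refl (fun ε : ℝ => ε) (𝓝[>] 0)).mul_isLittleO h2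
  have h4 := ((S.eigenvalue_sub_effectiveEigenvalue_isBigO s i).trans_isLittleO h1).add
    (h3.congr_right fun ε => by ring : _ =o[𝓝[>] 0] fun ε : ℝ => ε ^ 2)
  refine h4.congr_left fun ε => ?_
  simp only [smul_eq_mul]
  ring

theorem isApproxUpToOrder_two {i : Fin D} {b : ℝ}
    (hb : HasDerivWithinAt (S.effectiveEigenvalue s i) b (Set.Ioi 0) 0) :
    IsApproxUpToOrder 2 (S.eigenvalue s i)
      (Polynomial.C (S.effectiveEigenvalue s i 0) * Polynomial.X +
        Polynomial.C b * Polynomial.X ^ 2) := by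
  refine ⟨by compute_degree, ?_⟩
  simpa using S.eigenvalue_sub_isLittleO s hb

theorem isApproxUpToOrder_one (i : Fin D) :
    IsApproxUpToOrder 1 (S.eigenvalue s i)
      (Polynomial.C (S.effectiveEigenvalue s i 0) * Polynomial.X) := by
  obtain ⟨b, hb⟩ := S.exists_hasDerivWithinAt_effectiveEigenvalue s i
  have h1 : (fun ε : ℝ => ε ^ 2) =o[𝓝[>] 0] fun ε : ℝ => ε ^ 1 :=
    (isLittleO_pow_pow (by norm_num : 1 < 2)).mono nhdsWithin_le_nhds
  refine ⟨by compute_degree, ?_⟩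
  refine (((S.eigenvalue_sub_isLittleO s hb).trans h1).add
    (h1.const_mul_left b)).congr_left fun ε => ?_
  simp
  ring

theorem effectiveEigenvalue_le {t : ∀ k, V k} (ht : ∀ k, (S.sub k).IsMaxInfoCentrality (t k))
    (i : Fin D) {ε : ℝ} (hε : 0 ≤ ε) :
    S.effectiveEigenvalue s i ε ≤ S.effectiveEigenvalue t i ε := by
  refine ascEigenvalue_le_of_form_le _ _ (fun x => ?_) _
  simp only [sub_mulVec, smul_mulVec, dotProduct_sub, dotProduct_smul, smul_eq_mul]
  refine sub_le_sub_left (mul_le_mul_of_nonneg_left ?_ hε) _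
  rw [secondOrderMatrix_form, secondOrderMatrix_form]
  exact Finset.sum_le_sum fun k _ => mul_le_mul_of_nonneg_right
    ((ht k).lapPinv_le (S.connected k) (s k)) (sq_nonneg _)

/-- The two functions agree at `0` and are ordered to its right, so their difference quotients are
ordered too. -/
theorem deriv_effectiveEigenvalue_le {t : ∀ k, V k}
    (ht : ∀ k, (S.sub k).IsMaxInfoCentrality (t k)) {i : Fin D} {b c : ℝ}
    (hb : HasDerivWithinAt (S.effectiveEigenvalue s i) b (Set.Ioi 0) 0)
    (hc : HasDerivWithinAt (S.effectiveEigenvalue t i) c (Set.Ioi 0) 0) : b ≤ c := by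
  rw [hasDerivWithinAt_iff_tendsto_slope' (by simp)] at hb hc
  refine le_of_tendsto_of_tendsto hb hc ?_
  filter_upwards [self_mem_nhdsWithin] with ε hε
  rw [slope_def_field, slope_def_field, S.effectiveEigenvalue_zero s, S.effectiveEigenvalue_zero t]
  have hε' : 0 < ε := hε
  have := S.effectiveEigenvalue_le s ht i hε'.le
  gcongr

theorem eigenvalue_pos (hcon : S.con.graph.Connected) {i : Fin D} (hi : 1 ≤ (i : ℕ)) {ε : ℝ}
    (hε : 0 < ε) : 0 < S.eigenvalue s i ε := by
  by_contra hneg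
  -- The single condition of zero coordinate sum, affordable because `1 ≤ i`, excludes the nonzero
  -- constant vectors, the only ones on which the form could vanish.
  let F : ((Σ k, V k) → ℝ) →ₗ[ℝ] ℝ := ∑ p, LinearMap.proj p
  obtain ⟨x, hx0, hF, hx⟩ := exists_ne_zero_form_le (S.supraLaplacian_isHermitian s ε)
    (Fin.castLE (le_card s) i) F (by simpa using hi)
  have hle : x ⬝ᵥ S.supraLaplacian s ε *ᵥ x ≤ 0 :=
    hx.trans (mul_nonpos_of_nonpos_of_nonneg (not_lt.mp hneg) (dotProduct_self_nonneg_real x))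
  rw [supraLaplacian, add_mulVec, smul_mulVec, dotProduct_add, dotProduct_smul, smul_eq_mul,
    blockDiagonal'_form] at hle
  have hk : ∀ k, 0 ≤ (fun u => x ⟨k, u⟩) ⬝ᵥ (S.sub k).lap *ᵥ fun u => x ⟨k, u⟩ := fun k =>
    (S.sub k).lap_form_nonneg _
  have hsum := Finset.sum_nonneg fun k (_ : k ∈ Finset.univ) => hk k
  have hcn := (S.connectingGraph s).lap_form_nonneg x
  have hcn' := mul_nonneg hε.le hcn
  have h1 := (Finset.sum_eq_zero_iff_of_nonneg fun k _ => hk k).mp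
    (le_antisymm (by linarith) hsum)
  have h2 : x ⬝ᵥ (S.connectingGraph s).lap *ᵥ x = 0 :=
    (mul_eq_zero.mp (le_antisymm (by linarith) hcn')).resolve_left hε.ne'
  rw [connectingGraph_lap, ← mulVec_mulVec, ← mulVec_mulVec, dotProduct_mulVec,
    vecMul_transpose] at h2
  have hnode : ∀ k v, x ⟨k, v⟩ = x ⟨k, s k⟩ := fun k v =>
    WeightedGraph.eq_of_lap_form_eq_zero (S.connected k) (h1 k (Finset.mem_univ k)) v (s k)
  have hall : ∀ k l, x ⟨k, s k⟩ = x ⟨l, s l⟩ := fun k l => by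
    have := WeightedGraph.eq_of_lap_form_eq_zero hcon h2 k l
    rwa [evalMatrix_mulVec, evalMatrix_mulVec] at this
  have hconst : ∀ p, x p = x ⟨i, s i⟩ := fun p => (hnode p.1 p.2).trans (hall p.1 i)
  have hF' : ∑ p, x p = 0 := by simpa [F] using hF
  rw [Finset.sum_congr rfl fun p _ => hconst p, Finset.sum_const, Finset.card_univ,
    nsmul_eq_mul] at hF'
  have : Nonempty (Σ k, V k) := ⟨⟨i, s i⟩⟩
  have hz : x ⟨i, s i⟩ = 0 :=
    (mul_eq_zero.mp hF').resolve_left (by exact_mod_cast Fintype.card_ne_zero)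
  exact hx0 (funext fun p => (hconst p).trans hz)

end NetworkOfNetworks

end Network

theorem mainTheorem3 {D : ℕ} {V : Fin D → Type*} [∀ k, Fintype (V k)] [∀ k, DecidableEq (V k)]
    (S : NetworkOfNetworks D V) :
    -- for a connected network, the eigenvalues in question are nonzero
    (S.con.graph.Connected → ∀ i : Fin D, 1 ≤ (i : ℕ) → ∀ s : (∀ k, V k), ∀ ε : ℝ, 0 < ε →
      0 < S.eigenvalue s i ε) ∧
    -- the first-order approximation does not depend on the connecting nodes
    (∀ i : Fin D, 1 ≤ (i : ℕ) → ∃ p₁ : Polynomial ℝ, ∀ s : (∀ k, V k),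
      IsApproxUpToOrder 1 (S.eigenvalue s i) p₁) ∧
    -- the second-order approximation is largest for nodes of maximum information centrality
    (∀ i : Fin D, 1 ≤ (i : ℕ) → ∃ p₂ : (∀ k, V k) → Polynomial ℝ,
      (∀ s : (∀ k, V k), IsApproxUpToOrder 2 (S.eigenvalue s i) (p₂ s)) ∧
      ∀ t : (∀ k, V k), (∀ k, (S.sub k).IsMaxInfoCentrality (t k)) →
        ∀ s : (∀ k, V k), ∀ ε : ℝ, 0 < ε → (p₂ s).eval ε ≤ (p₂ t).eval ε) ∧
    -- a node of maximum information centrality minimizes the diagonal of the pseudoinverse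
    (∀ k, ∀ r : V k, (S.sub k).IsMaxInfoCentrality r → ∀ v : V k,
      symmPinv (S.sub k).lap_isHermitian r r ≤ symmPinv (S.sub k).lap_isHermitian v v) := by
  refine ⟨fun hcon i hi s ε hε => S.eigenvalue_pos s hcon hi hε, fun i _ => ?_, fun i _ => ?_,
    fun k r hr v => hr.lapPinv_le (S.connected k) v⟩
  · exact ⟨Polynomial.C (ascEigenvalue S.firstOrderMatrix_isHermitian
      (Fin.cast (Fintype.card_fin D).symm i)) * Polynomial.X,
      fun s => S.effectiveEigenvalue_zero s i ▸ S.isApproxUpToOrder_one s i⟩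
  · choose b hb using fun s => S.exists_hasDerivWithinAt_effectiveEigenvalue s i
    refine ⟨fun s => _, fun s => S.isApproxUpToOrder_two s (hb s), fun t ht s ε _ => ?_⟩
    have h := mul_le_mul_of_nonneg_right (S.deriv_effectiveEigenvalue_le s ht (hb s) (hb t))
      (sq_nonneg ε)
    simp only [Polynomial.eval_add, Polynomial.eval_mul, Polynomial.eval_C, Polynomial.eval_X,
      Polynomial.eval_pow, S.effectiveEigenvalue_zero s, S.effectiveEigenvalue_zero t]
    linarith
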